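/- Let $v\ge 0$ and $T\ge 1$ be integers, let $P(x)=x^{2\cdot 3^v}+x^{3^v}+1\in\mathbb{F}_2[x]$, and let $n=\deg P(x)^{2^T}=3^v2^{T+1}$. Identify a word $(c_0,\dots,c_{n-1})\in\mathbb{F}_2^n$ with the residue class of $c_0+c_1x+\dots+c_{n-1}x^{n-1}$ in $\mathbb{F}_2[x]/\langle P(x)^{2^T}\rangle$, and let $C_1\subseteq\mathbb{F}_2^n$ be the binary linear code corresponding to the ideal of this ring generated by $P(x)$. Let $C_1^\perp$ be its dual with respect to the Euclidean inner product $\sum_i a_ic_i$. Then both $C_1$ and $C_1^\perp$ are LCD codes (a linear code $C$ is LCD if $C\cap C^\perp=\{0\}$). Their parameters [length, dimension, minimum Hamming distance] are $$\left[3^v2^{T+1},\;3^v\left(2^{T+1}-2\right),\;2\right]\quad\text{and}\quad\left[3^v2^{T+1},\;2\cdot 3^v,\;d_1^\perp\right]$$ respectively, where $d_1^\perp=\frac{2^{T+2}-2}{3}$ if $T$ is odd and $d_1^\perp=\frac{2^{T+2}-1}{3}$ if $T$ is even. -/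

import Mathlib

open Polynomial

noncomputable section

namespace PolycyclicCode

/-- The identification of a word `(c_0, …, c_{n-1})` with the polynomial
`c_0 + c_1 x + ⋯ + c_{n-1} x^{n-1}`. -/
def wordPoly (F : Type*) [Field F] (n : ℕ) : (Fin n → F) →ₗ[F] F[X] :=
  ∑ i : Fin n, (monomial (R := F) (i : ℕ)).comp (LinearMap.proj i)

/-- The polycyclic code associated with `f` that corresponds to the ideal `I` of `F[x]/⟨f⟩`:
the words of length `deg f` whose polynomial has its residue class in `I`. -/
def polycyclicCode {F : Type*} [Field F] (f : F[X]) (I : Ideal (F[X] ⧸ Ideal.span {f})) :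
    Submodule F (Fin f.natDegree → F) :=
  (Submodule.restrictScalars F I).comap
    ((Ideal.Quotient.mkₐ F (Ideal.span {f})).toLinearMap ∘ₗ wordPoly F f.natDegree)

/-- The Euclidean dual of a linear code. -/
def dualCode {F ι : Type*} [Field F] [Fintype ι] (C : Submodule F (ι → F)) :
    Submodule F (ι → F) where
  carrier := {a | ∀ c ∈ C, ∑ i, a i * c i = 0}
  add_mem' := by
    intro a b ha hb c hc
    simp [add_mul, Finset.sum_add_distrib, ha c hc, hb c hc]
  zero_mem' := by
    intro c _
    simp
  smul_mem' := by
    intro r a ha c hc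
    simp [mul_assoc, ← Finset.mul_sum, ha c hc]

/-- A linear code is LCD (linear complementary dual) if it meets its Euclidean dual trivially. -/
def IsLCD {F ι : Type*} [Field F] [Fintype ι] (C : Submodule F (ι → F)) : Prop :=
  C ⊓ dualCode C = ⊥

/-- `d` is the minimum Hamming distance of `C`: the least distance between two distinct
codewords (so that such codewords exist). -/
def IsMinDist {F ι : Type*} [Field F] [DecidableEq F] [Fintype ι]
    (C : Submodule F (ι → F)) (d : ℕ) : Prop :=
  IsLeast {k : ℕ | ∃ a ∈ C, ∃ b ∈ C, a ≠ b ∧ hammingDist a b = k} d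

/-- `C` has parameters `[n, k, d]`: length `n`, dimension `k`, minimum Hamming distance `d`. -/
def HasParameters {F ι : Type*} [Field F] [DecidableEq F] [Fintype ι]
    (C : Submodule F (ι → F)) (n k d : ℕ) : Prop :=
  Fintype.card ι = n ∧ Module.finrank F C = k ∧ IsMinDist C d

/-- The binary trinomial `x^{2·3^v} + x^{3^v} + 1`. -/
def trinomial (v : ℕ) : (ZMod 2)[X] := X ^ (2 * 3 ^ v) + X ^ (3 ^ v) + 1

/-- The binary polycyclic code `C_j = ⟨P(x)^j⟩ ⊆ F_2[x]/⟨P(x)^L⟩`. -/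
def powerCode (P : (ZMod 2)[X]) (L j : ℕ) : Submodule (ZMod 2) (Fin (P ^ L).natDegree → ZMod 2) :=
  polycyclicCode (P ^ L)
    (Ideal.span {Ideal.Quotient.mk (Ideal.span {P ^ L}) (P ^ j)})

end PolycyclicCode

end

namespace PolycyclicCode

/-! ### Codes from divisors of the modulus, and Euclidean duality -/

section General

variable {F : Type*} [Field F]

/-! Put m = 3^v and N = 2^(T+1), so n = mN. Pairing with the multiples P·x^i shows that the dual
consists of the words obeying g_i + g_{i+m} + g_{i+2m} = 0. Splitting indices by residue mod m gives
m independent columns of length N, each obeying s_k + s_{k+1} + s_{k+2} = 0, hence of period three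
with two ones per period when nonzero. Write N = 3q + e with e = 1 or 2. A nonzero column has weight
at least 2q + e - 1 (`le_sum_ne_zero_of_recurrence`), attained by starting at its zero. As N is even
and prime to 3, the dot product is nondegenerate on such columns
(`eq_zero_of_recurrence_of_sum_eq_zero`), which gives LCD. In C₁ the word x^(3m) + 1 has weight 2,
and weight 1 is impossible because no coordinate vanishes on the whole dual. -/

theorem wordPoly_apply (n : ℕ) (c : Fin n → F) :
    wordPoly F n c = ∑ i : Fin n, monomial (i : ℕ) (c i) := by
  simp [wordPoly]

theorem wordPoly_coeff (p : F[X]) (n : ℕ) (hp : p.natDegree < n) :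
    wordPoly F n (fun i => p.coeff i) = p := by
  rw [wordPoly_apply, Fin.sum_univ_eq_sum_range (fun i => monomial i (p.coeff i)) n]
  exact (p.as_sum_range' n hp).symm

theorem mem_polycyclicCode_span_iff {f p : F[X]} (hpf : p ∣ f) (c : Fin f.natDegree → F) :
    c ∈ polycyclicCode f (Ideal.span {Ideal.Quotient.mk (Ideal.span {f}) p}) ↔
      p ∣ wordPoly F f.natDegree c := by
  change Ideal.Quotient.mk (Ideal.span {f}) (wordPoly F f.natDegree c) ∈
    Ideal.span {Ideal.Quotient.mk (Ideal.span {f}) p} ↔ _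
  rw [Ideal.mem_span_singleton]
  constructor
  · rintro ⟨q, hq⟩
    obtain ⟨q, rfl⟩ := Ideal.Quotient.mk_surjective q
    rw [← map_mul, Ideal.Quotient.eq, Ideal.mem_span_singleton] at hq
    have := (hpf.trans hq).add (dvd_mul_right p q)
    simpa using this
  · exact fun h => map_dvd _ h

/-- The code is the kernel of the map from words to F[x]/⟨p⟩, surjective because remainders mod p
fit in the available coordinates. -/
theorem finrank_polycyclicCode_span {f p : F[X]} (hpf : p ∣ f) (hp : p.Monic)
    (hdeg : p.natDegree ≤ f.natDegree) (hf : 0 < f.natDegree) :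
    Module.finrank F (polycyclicCode f (Ideal.span {Ideal.Quotient.mk (Ideal.span {f}) p})) =
      f.natDegree - p.natDegree := by
  let φ : (Fin f.natDegree → F) →ₗ[F] F[X] ⧸ Ideal.span {p} :=
    (Ideal.Quotient.mkₐ F (Ideal.span {p})).toLinearMap ∘ₗ wordPoly F f.natDegree
  have hker : polycyclicCode f (Ideal.span {Ideal.Quotient.mk (Ideal.span {f}) p}) =
      LinearMap.ker φ := by
    ext c
    rw [mem_polycyclicCode_span_iff hpf, LinearMap.mem_ker]
    change _ ↔ Ideal.Quotient.mk (Ideal.span {p}) _ = 0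
    rw [Ideal.Quotient.eq_zero_iff_mem, Ideal.mem_span_singleton]
  have hsurj : Function.Surjective φ := by
    intro y
    obtain ⟨y, rfl⟩ := Ideal.Quotient.mk_surjective y
    have hlt : (y %ₘ p).natDegree < f.natDegree := by
      by_cases h1 : p = 1
      · simpa [h1] using hf
      · exact (natDegree_modByMonic_lt y hp h1).trans_le hdeg
    refine ⟨fun i => (y %ₘ p).coeff i, ?_⟩
    change Ideal.Quotient.mk (Ideal.span {p}) (wordPoly F f.natDegree _) = _
    rw [wordPoly_coeff _ _ hlt, Ideal.Quotient.eq, Ideal.mem_span_singleton]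
    exact ⟨-(y /ₘ p), by linear_combination modByMonic_add_div y p⟩
  have h := LinearMap.finrank_range_add_finrank_ker φ
  rw [LinearMap.range_eq_top.2 hsurj, finrank_top, finrank_quotient_span_eq_natDegree,
    Module.finrank_fin_fun, ← hker] at h
  omega

variable {ι : Type*} [Fintype ι]

theorem mem_dualCode_iff (C : Submodule F (ι → F)) (a : ι → F) :
    a ∈ dualCode C ↔ ∀ c ∈ C, ∑ i, a i * c i = 0 := Iff.rfl

theorem dualCode_eq_orthogonal [DecidableEq ι] (C : Submodule F (ι → F)) :
    dualCode C = LinearMap.BilinForm.orthogonal (dotProductBilin F F) C := by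
  ext a
  rw [mem_dualCode_iff, LinearMap.BilinForm.mem_orthogonal_iff]
  refine forall₂_congr fun c _ => ?_
  simp [dotProductBilin, dotProduct, mul_comm]

theorem nondegenerate_dotProductBilin [DecidableEq ι] :
    LinearMap.BilinForm.Nondegenerate (dotProductBilin F F : LinearMap.BilinForm F (ι → F)) := by
  constructor
  · intro a ha
    ext i
    simpa [dotProductBilin] using ha (Pi.single i 1)
  · intro a ha
    ext i
    simpa [dotProductBilin] using ha (Pi.single i 1)

theorem isRefl_dotProductBilin :
    LinearMap.BilinForm.IsRefl (dotProductBilin F F : LinearMap.BilinForm F (ι → F)) := by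
  intro a b h
  simpa [dotProductBilin, dotProduct_comm] using h

theorem dualCode_dualCode (C : Submodule F (ι → F)) : dualCode (dualCode C) = C := by
  classical
  rw [dualCode_eq_orthogonal, dualCode_eq_orthogonal]
  exact LinearMap.BilinForm.orthogonal_orthogonal nondegenerate_dotProductBilin
    isRefl_dotProductBilin C

theorem finrank_dualCode (C : Submodule F (ι → F)) :
    Module.finrank F (dualCode C) = Fintype.card ι - Module.finrank F C := by
  classical
  rw [dualCode_eq_orthogonal, ← Module.finrank_fintype_fun_eq_card F]
  exact LinearMap.BilinForm.finrank_orthogonal nondegenerate_dotProductBilin C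

theorem IsLCD.dualCode {C : Submodule F (ι → F)} (h : IsLCD C) :
    IsLCD (PolycyclicCode.dualCode C) := by
  rw [IsLCD, dualCode_dualCode, inf_comm]
  exact h

theorem isMinDist_of_hammingNorm [DecidableEq F] {C : Submodule F (ι → F)} {d : ℕ}
    {w : ι → F} (hw : w ∈ C) (hw0 : w ≠ 0) (hwd : hammingNorm w = d)
    (hmin : ∀ a ∈ C, a ≠ 0 → d ≤ hammingNorm a) : IsMinDist C d := by
  refine ⟨⟨w, hw, 0, C.zero_mem, hw0, by simpa using hwd⟩, ?_⟩
  rintro _ ⟨a, ha, b, hb, hab, rfl⟩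
  rw [hammingDist_eq_hammingNorm]
  refine hmin _ (C.add_mem (C.neg_mem ha) hb) fun h => hab ?_
  exact (neg_add_eq_zero.1 h)

/-- The linear functional on polynomials pairing coefficients with the sequence `g`. -/
def coeffPairing (g : ℕ → F) : F[X] →ₗ[F] F :=
  Polynomial.lsum fun i => LinearMap.mulRight F (g i)

@[simp]
theorem coeffPairing_monomial (g : ℕ → F) (i : ℕ) (c : F) :
    coeffPairing g (monomial i c) = c * g i := by
  simp [coeffPairing, Polynomial.lsum_apply, Polynomial.sum_monomial_index]

theorem coeffPairing_wordPoly (g : ℕ → F) (n : ℕ) (c : Fin n → F) :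
    coeffPairing g (wordPoly F n c) = ∑ i : Fin n, c i * g i := by
  simp [wordPoly_apply]

theorem coeffPairing_mul_eq_zero {g : ℕ → F} {p : F[X]}
    (h : ∀ i, coeffPairing g (p * X ^ i) = 0) (q : F[X]) : coeffPairing g (p * q) = 0 := by
  induction q using Polynomial.induction_on' with
  | add q r hq hr => rw [mul_add, map_add, hq, hr, add_zero]
  | monomial i c =>
    rw [← C_mul_X_pow_eq_monomial, mul_left_comm, ← smul_eq_C_mul, map_smul, h, smul_zero]

theorem comp_val_mem_dualCode {f p : F[X]} (hpf : p ∣ f) {g : ℕ → F}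
    (h : ∀ i, coeffPairing g (p * X ^ i) = 0) :
    (fun i : Fin f.natDegree => g i) ∈
      dualCode (polycyclicCode f (Ideal.span {Ideal.Quotient.mk (Ideal.span {f}) p})) := by
  intro c hc
  obtain ⟨q, hq⟩ := (mem_polycyclicCode_span_iff hpf c).1 hc
  rw [Finset.sum_congr rfl fun i _ => mul_comm _ _, ← coeffPairing_wordPoly, hq]
  exact coeffPairing_mul_eq_zero h q

/-- The degree bound is essential: values of g beyond the word are unconstrained. -/
theorem coeffPairing_eq_zero_of_mem_dualCode {f p : F[X]} (hpf : p ∣ f) {g : ℕ → F}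
    (h : (fun i : Fin f.natDegree => g i) ∈
      dualCode (polycyclicCode f (Ideal.span {Ideal.Quotient.mk (Ideal.span {f}) p})))
    {q : F[X]} (hpq : p ∣ q) (hq : q.natDegree < f.natDegree) : coeffPairing g q = 0 := by
  have hw := wordPoly_coeff q _ hq
  have := h (fun i => q.coeff i) ((mem_polycyclicCode_span_iff hpf _).2 (by rwa [hw]))
  rw [← hw, coeffPairing_wordPoly]
  simpa only [mul_comm] using this

end General

/-! ### Binary sequences with s_k + s_{k+1} + s_{k+2} = 0 -/

section Periodic

theorem sum_range_mul_eq {M : Type*} [AddCommMonoid M] (f : ℕ → M) (N m : ℕ) :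
    ∑ i ∈ Finset.range (N * m), f i =
      ∑ j ∈ Finset.range m, ∑ k ∈ Finset.range N, f (k * m + j) := by
  rw [Finset.sum_comm]
  induction N with
  | zero => simp
  | succ N ih => rw [Nat.succ_mul, Finset.sum_range_add, ih, Finset.sum_range_succ]

theorem sum_range_of_period_three {M : Type*} [AddCommMonoid M] {f : ℕ → M} {N : ℕ}
    (hf : ∀ k, k + 3 < N → f (k + 3) = f k) {q e : ℕ} (he : e < 3) (hN : 3 * q + e = N) :
    ∑ k ∈ Finset.range N, f k = q • (f 0 + f 1 + f 2) + ∑ k ∈ Finset.range e, f k := by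
  have key : ∀ q r, 3 * q + r < N → f (3 * q + r) = f r := by
    intro q r
    induction q with
    | zero => simp
    | succ q ih =>
      intro h
      rw [show 3 * (q + 1) + r = 3 * q + r + 3 by ring, hf _ (by omega), ih (by omega)]
  have main : ∀ s, 3 * s ≤ N → ∑ k ∈ Finset.range (3 * s), f k = s • (f 0 + f 1 + f 2) := by
    intro s
    induction s with
    | zero => simp
    | succ s ih =>
      intro h
      rw [Nat.mul_succ, Finset.sum_range_succ, Finset.sum_range_succ, Finset.sum_range_succ,
        ih (by omega), succ_nsmul, add_assoc (3 * s) 1 1, key s 1 (by omega), key s 2 (by omega),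
        show f (3 * s) = f 0 from key s 0 (by omega)]
      simp only [add_assoc]
  rw [← hN, Finset.sum_range_add, main q (by omega)]
  congr 1
  refine Finset.sum_congr rfl fun k hk => key q k ?_
  have := Finset.mem_range.1 hk
  omega

variable {N : ℕ} {s : ℕ → ZMod 2}

theorem eq_of_recurrence (hs : ∀ k, k + 2 < N → s k + s (k + 1) + s (k + 2) = 0) (k : ℕ)
    (hk : k + 3 < N) : s (k + 3) = s k := by
  linear_combination hs (k + 1) (by omega) - hs k (by omega)

theorem ne_zero_of_recurrence (hs : ∀ k, k + 2 < N → s k + s (k + 1) + s (k + 2) = 0)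
    {k : ℕ} (hk : k < N) (hsk : s k ≠ 0) : s 0 ≠ 0 ∨ s 1 ≠ 0 := by
  by_contra! h
  have : ∀ j, j < N → s j = 0 := by
    intro j
    induction j using Nat.strong_induction_on with
    | _ j ih =>
      intro hj
      match j, ih, hj with
      | 0, _, _ => exact h.1
      | 1, _, _ => exact h.2
      | j + 2, ih, hj =>
        have := hs j hj
        rwa [ih j (by omega) (by omega), ih (j + 1) (by omega) (by omega), zero_add,
          zero_add] at this
  exact hsk (this k hk)

/-- The least weight of a nonzero word of length `3q+1` or `3q+2` satisfying the recurrence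
with characteristic polynomial `X²+X+1`. -/
theorem le_sum_ne_zero_of_recurrence (hN : 3 ≤ N)
    (hs : ∀ k, k + 2 < N → s k + s (k + 1) + s (k + 2) = 0)
    (h0 : s 0 ≠ 0 ∨ s 1 ≠ 0) {q e : ℕ} (he : e = 1 ∨ e = 2) (hqe : 3 * q + e = N) :
    2 * q + (e - 1) ≤ ∑ k ∈ Finset.range N, if s k ≠ 0 then 1 else 0 := by
  rw [sum_range_of_period_three (fun k hk => by rw [eq_of_recurrence hs k hk]) (by omega) hqe]
  have h2 := hs 0 (by omega)
  -- A nonzero period has exactly two ones, at least one of them among its first two entries; the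
  -- latter bounds the tail when e = 2.
  have h01 : ∀ a b c : ZMod 2, a + b + c = 0 → (a ≠ 0 ∨ b ≠ 0) →
      ((if a ≠ 0 then 1 else 0) + (if b ≠ 0 then 1 else 0) + (if c ≠ 0 then 1 else 0) = 2) ∧
      1 ≤ (if a ≠ 0 then 1 else 0) + (if b ≠ 0 then 1 else 0) := by decide
  obtain ⟨ha, hb⟩ := h01 _ _ _ h2 h0
  have ha' : ((if s 0 ≠ 0 then 1 else 0) + (if s 1 ≠ 0 then 1 else 0) +
    (if s 2 ≠ 0 then 1 else 0) : ℕ) = 2 := ha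
  rw [ha', smul_eq_mul]
  rcases he with rfl | rfl
  · omega
  · rw [Finset.sum_range_succ, Finset.sum_range_one]
    have hb' : 1 ≤ ((if s 0 ≠ 0 then 1 else 0) + (if s 1 ≠ 0 then 1 else 0) : ℕ) := hb
    omega

/-- The binary sequence of period three vanishing exactly on the residue class of `r`. -/
def periodicSeq (r k : ℕ) : ZMod 2 := if k % 3 = r % 3 then 0 else 1

theorem periodicSeq_recurrence (r k : ℕ) :
    periodicSeq r k + periodicSeq r (k + 1) + periodicSeq r (k + 2) = 0 := by
  have h11 : (1 : ZMod 2) + 1 = 0 := rfl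
  unfold periodicSeq
  rcases (by omega : k % 3 = r % 3 ∨ (k + 1) % 3 = r % 3 ∨ (k + 2) % 3 = r % 3) with h | h | h
  · rw [if_pos h, if_neg (by omega), if_neg (by omega), zero_add, h11]
  · rw [if_neg (by omega), if_pos h, if_neg (by omega), add_zero, h11]
  · rw [if_neg (by omega), if_neg (by omega), if_pos h, add_zero, h11]

theorem sum_periodicSeq_zero_ne_zero {q e : ℕ} (he : e = 1 ∨ e = 2)
    (hqe : 3 * q + e = N) :
    (∑ k ∈ Finset.range N, if periodicSeq 0 k ≠ 0 then 1 else 0) = 2 * q + (e - 1) := by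
  rw [sum_range_of_period_three (q := q) (e := e) (fun k _ => by simp [periodicSeq]) (by omega)
    hqe]
  rcases he with rfl | rfl <;> simp [periodicSeq, Finset.sum_range_succ, mul_comm]

/-- Testing against r = 0 and r = 1 suffices. Since N is even, q has the parity of e: for e = 2 the
full periods cancel and the tail reads off s 1 and s 0; for e = 1 they contribute once. -/
theorem eq_zero_of_recurrence_of_sum_eq_zero (hN : 3 ≤ N) (hN2 : Even N)
    (hs : ∀ k, k + 2 < N → s k + s (k + 1) + s (k + 2) = 0)
    {q e : ℕ} (he : e = 1 ∨ e = 2) (hqe : 3 * q + e = N)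
    (horth : ∀ r, ∑ k ∈ Finset.range N, s k * periodicSeq r k = 0) : s 0 = 0 ∧ s 1 = 0 := by
  have h2 := hs 0 (by omega)
  have h := fun r => horth r
  simp_rw [fun r => sum_range_of_period_three (f := fun k => s k * periodicSeq r k)
    (fun k hk => by simp only [eq_of_recurrence hs k hk, periodicSeq, Nat.add_mod_right])
    (by omega) hqe] at h
  have h0 := h 0
  have h1 := h 1
  have fin1 : ∀ a b c : ZMod 2, a + b + c = 0 → b + c = 0 → a + c + a = 0 → a = 0 ∧ b = 0 := by
    decide
  rcases he with rfl | rfl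
  · have hq : Odd q := by
      rw [← Nat.not_even_iff_odd]; intro hq
      rw [Nat.even_iff] at *; omega
    have hq' : (q : ZMod 2) = 1 := (ZMod.natCast_eq_one_iff_odd).2 hq
    simp [periodicSeq, nsmul_eq_mul, hq'] at h0 h1
    exact fin1 _ _ _ h2 h0 h1
  · have hq : Even q := by rw [Nat.even_iff] at *; omega
    have hq' : (q : ZMod 2) = 0 := (ZMod.natCast_eq_zero_iff_even).2 hq
    simp [periodicSeq, nsmul_eq_mul, hq', Finset.sum_range_succ] at h0 h1
    exact ⟨h1, h0⟩

end Periodic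

/-! ### The code of the trinomial, column by column -/

section Trinomial

variable (v : ℕ)

theorem trinomial_eq : trinomial v = Polynomial.trinomial 0 (3 ^ v) (2 * 3 ^ v) 1 1 1 := by
  simp only [trinomial, Polynomial.trinomial, map_one, one_mul, pow_zero]
  ring

theorem natDegree_trinomial : (trinomial v).natDegree = 2 * 3 ^ v := by
  have : 0 < 3 ^ v := by positivity
  rw [trinomial_eq]
  exact Polynomial.trinomial_natDegree this (by omega) one_ne_zero

theorem monic_trinomial : (trinomial v).Monic := by
  have : 0 < 3 ^ v := by positivity
  rw [trinomial_eq]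
  exact Polynomial.trinomial_monic this (by omega)

theorem natDegree_trinomial_pow (T : ℕ) :
    (trinomial v ^ 2 ^ T).natDegree = 2 ^ (T + 1) * 3 ^ v := by
  rw [natDegree_pow, natDegree_trinomial]
  ring

theorem coeffPairing_trinomial_mul_X_pow (g : ℕ → ZMod 2) (i : ℕ) :
    coeffPairing g (trinomial v * X ^ i) = g i + g (i + 3 ^ v) + g (i + 2 * 3 ^ v) := by
  have : trinomial v * X ^ i =
      monomial i 1 + monomial (i + 3 ^ v) 1 + monomial (i + 2 * 3 ^ v) 1 := by
    simp only [trinomial, ← X_pow_eq_monomial]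
    ring
  simp [this]

variable {v} {T : ℕ}

theorem trinomial_dvd_pow : trinomial v ∣ trinomial v ^ 2 ^ T :=
  dvd_pow_self _ (by positivity)

theorem powerCode_one_eq (P : (ZMod 2)[X]) (L : ℕ) : powerCode P L 1 =
    polycyclicCode (P ^ L) (Ideal.span {Ideal.Quotient.mk (Ideal.span {P ^ L}) P}) := by
  rw [powerCode, pow_one]

theorem comp_val_mem_dualCode_powerCode {g : ℕ → ZMod 2}
    (hg : ∀ i, g i + g (i + 3 ^ v) + g (i + 2 * 3 ^ v) = 0) :
    (fun i : Fin (trinomial v ^ 2 ^ T).natDegree => g i) ∈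
      dualCode (powerCode (trinomial v) (2 ^ T) 1) := by
  rw [powerCode_one_eq]
  exact comp_val_mem_dualCode trinomial_dvd_pow fun i => by
    rw [coeffPairing_trinomial_mul_X_pow, hg]

theorem exists_comp_val_eq {n : ℕ} (a : Fin n → ZMod 2) :
    ∃ g : ℕ → ZMod 2, a = fun i : Fin n => g i :=
  ⟨fun i => if h : i < n then a ⟨i, h⟩ else 0, by ext i; simp⟩

theorem recurrence_of_mem_dualCode_powerCode {g : ℕ → ZMod 2}
    (h : (fun i : Fin (trinomial v ^ 2 ^ T).natDegree => g i) ∈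
      dualCode (powerCode (trinomial v) (2 ^ T) 1)) {j : ℕ} (hj : j < 3 ^ v) (k : ℕ)
    (hk : k + 2 < 2 ^ (T + 1)) :
    g (k * 3 ^ v + j) + g ((k + 1) * 3 ^ v + j) + g ((k + 2) * 3 ^ v + j) = 0 := by
  rw [powerCode_one_eq] at h
  have := coeffPairing_eq_zero_of_mem_dualCode trinomial_dvd_pow h
    (dvd_mul_right (trinomial v) (X ^ (k * 3 ^ v + j))) (by
      rw [(monic_trinomial v).natDegree_mul (monic_X_pow _), natDegree_X_pow, natDegree_trinomial,
        natDegree_trinomial_pow]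
      -- The degree is (k+2)·3^v + j < (k+3)·3^v ≤ n.
      have := Nat.mul_le_mul_right (3 ^ v) (show k + 3 ≤ 2 ^ (T + 1) from hk)
      linarith)
  rw [coeffPairing_trinomial_mul_X_pow] at this
  convert this using 3 <;> ring_nf

/-- The binary sequence supported on the indices congruent to `j` modulo `m`, along which it is
the periodic sequence vanishing on the residue class of `r` modulo three. -/
def columnSeq (m j r i : ℕ) : ZMod 2 := if i % m = j then periodicSeq r (i / m) else 0

theorem columnSeq_recurrence {m : ℕ} (hm : 0 < m) (j r i : ℕ) :
    columnSeq m j r i + columnSeq m j r (i + m) + columnSeq m j r (i + 2 * m) = 0 := by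
  simp only [columnSeq, Nat.add_mod_right, Nat.add_mul_mod_self_right, Nat.add_div_right _ hm,
    Nat.add_mul_div_right _ _ hm]
  split_ifs
  · exact periodicSeq_recurrence r (i / m)
  · simp

theorem columnSeq_apply {m j' : ℕ} (hj' : j' < m) (j r k : ℕ) :
    columnSeq m j r (k * m + j') = if j' = j then periodicSeq r k else 0 := by
  have hm : 0 < m := by omega
  rw [columnSeq, mul_comm k m, Nat.mul_add_mod, Nat.mod_eq_of_lt hj', Nat.mul_add_div hm,
    Nat.div_eq_of_lt hj', add_zero]

theorem sum_comp_val {M : Type*} [AddCommMonoid M] (f : ℕ → M) :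
    ∑ i : Fin (trinomial v ^ 2 ^ T).natDegree, f i =
      ∑ j ∈ Finset.range (3 ^ v), ∑ k ∈ Finset.range (2 ^ (T + 1)), f (k * 3 ^ v + j) := by
  rw [Fin.sum_univ_eq_sum_range f, natDegree_trinomial_pow, sum_range_mul_eq]

theorem hammingNorm_comp_val (g : ℕ → ZMod 2) :
    hammingNorm (fun i : Fin (trinomial v ^ 2 ^ T).natDegree => g i) =
      ∑ j ∈ Finset.range (3 ^ v), ∑ k ∈ Finset.range (2 ^ (T + 1)),
        if g (k * 3 ^ v + j) ≠ 0 then 1 else 0 := by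
  rw [hammingNorm, Finset.card_filter]
  exact sum_comp_val fun i => if g i ≠ 0 then 1 else 0

theorem exists_block_index {i : ℕ} (hi : i < (trinomial v ^ 2 ^ T).natDegree) :
    ∃ k j, k < 2 ^ (T + 1) ∧ j < 3 ^ v ∧ i = k * 3 ^ v + j := by
  have hm : 0 < 3 ^ v := by positivity
  rw [natDegree_trinomial_pow] at hi
  exact ⟨i / 3 ^ v, i % 3 ^ v, (Nat.div_lt_iff_lt_mul hm).2 hi, Nat.mod_lt _ hm,
    (Nat.div_add_mod' i _).symm⟩

theorem four_le_two_pow_succ (hT : 1 ≤ T) : 4 ≤ 2 ^ (T + 1) :=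
  Nat.pow_le_pow_right (n := 2) (by norm_num) (show 2 ≤ T + 1 by omega)

theorem exists_two_pow_succ_eq (T : ℕ) : ∃ q e, (e = 1 ∨ e = 2) ∧ 3 * q + e = 2 ^ (T + 1) := by
  have h : 2 ^ (T + 1) % 3 ≠ 0 := fun h => by
    have := Nat.prime_three.dvd_of_dvd_pow (Nat.dvd_of_mod_eq_zero h)
    omega
  exact ⟨2 ^ (T + 1) / 3, 2 ^ (T + 1) % 3, by omega, Nat.div_add_mod _ _⟩

theorem isLCD_powerCode (hT : 1 ≤ T) : IsLCD (powerCode (trinomial v) (2 ^ T) 1) := by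
  have hm : 0 < 3 ^ v := by positivity
  have hN := four_le_two_pow_succ hT
  obtain ⟨q, e, he, hqe⟩ := exists_two_pow_succ_eq T
  refine (Submodule.eq_bot_iff _).2 fun a ⟨haC, haD⟩ => ?_
  obtain ⟨g, rfl⟩ := exists_comp_val_eq a
  ext ⟨i, hi⟩
  obtain ⟨k, j, hk, hj, rfl⟩ := exists_block_index hi
  have hrec := recurrence_of_mem_dualCode_powerCode haD hj
  have horth : ∀ r, ∑ k ∈ Finset.range (2 ^ (T + 1)), g (k * 3 ^ v + j) * periodicSeq r k = 0 := by
    intro r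
    -- A dual word supported on column j isolates that column of the codeword.
    have := comp_val_mem_dualCode_powerCode (T := T) (columnSeq_recurrence hm j r) _ haC
    rw [sum_comp_val fun i => columnSeq (3 ^ v) j r i * g i,
      Finset.sum_eq_single_of_mem j (Finset.mem_range.2 hj)] at this
    · simpa [columnSeq_apply hj, mul_comm] using this
    · intro j' hj' hne
      simp [columnSeq_apply (Finset.mem_range.1 hj'), hne]
  obtain ⟨h0, h1⟩ := eq_zero_of_recurrence_of_sum_eq_zero (s := fun k => g (k * 3 ^ v + j))
    (by omega) (by simp [Nat.even_pow]) hrec he hqe horth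
  by_contra hne
  exact (ne_zero_of_recurrence (s := fun k => g (k * 3 ^ v + j)) hrec hk hne).elim
    (fun h => h h0) (fun h => h h1)

theorem isMinDist_dualCode_powerCode (hT : 1 ≤ T) {q e : ℕ} (he : e = 1 ∨ e = 2)
    (hqe : 3 * q + e = 2 ^ (T + 1)) :
    IsMinDist (dualCode (powerCode (trinomial v) (2 ^ T) 1)) (2 * q + (e - 1)) := by
  have hm : 0 < 3 ^ v := by positivity
  have hN := four_le_two_pow_succ hT
  have hnorm : hammingNorm (fun i : Fin (trinomial v ^ 2 ^ T).natDegree =>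
      columnSeq (3 ^ v) 0 0 i) = 2 * q + (e - 1) := by
    rw [hammingNorm_comp_val (columnSeq (3 ^ v) 0 0),
      Finset.sum_eq_single_of_mem 0 (Finset.mem_range.2 hm),
      ← sum_periodicSeq_zero_ne_zero he hqe]
    · exact Finset.sum_congr rfl fun k _ => by rw [columnSeq_apply hm, if_pos rfl]
    · intro j hj hne
      simp [columnSeq_apply (Finset.mem_range.1 hj), hne]
  refine isMinDist_of_hammingNorm
    (comp_val_mem_dualCode_powerCode (columnSeq_recurrence hm 0 0)) ?_ hnorm ?_
  · rw [← hammingNorm_ne_zero_iff, hnorm]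
    omega
  · intro a ha ha0
    obtain ⟨g, rfl⟩ := exists_comp_val_eq a
    obtain ⟨⟨i, hi⟩, hgi⟩ := Function.ne_iff.1 ha0
    obtain ⟨k, j, hk, hj, rfl⟩ := exists_block_index hi
    have hrec := recurrence_of_mem_dualCode_powerCode ha hj
    rw [hammingNorm_comp_val]
    refine (le_sum_ne_zero_of_recurrence (s := fun k => g (k * 3 ^ v + j)) (by omega) hrec
      (ne_zero_of_recurrence (s := fun k => g (k * 3 ^ v + j)) hrec hk hgi) he hqe).trans ?_
    exact Finset.single_le_sum (f := fun j => ∑ k ∈ Finset.range (2 ^ (T + 1)),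
      if g (k * 3 ^ v + j) ≠ 0 then 1 else 0) (fun _ _ => Nat.zero_le _) (Finset.mem_range.2 hj)

theorem two_le_hammingNorm_of_mem_powerCode
    {a : Fin (trinomial v ^ 2 ^ T).natDegree → ZMod 2}
    (ha : a ∈ powerCode (trinomial v) (2 ^ T) 1) (ha0 : a ≠ 0) : 2 ≤ hammingNorm a := by
  have hm : 0 < 3 ^ v := by positivity
  by_contra! hlt
  obtain ⟨i, hi⟩ := Function.ne_iff.1 ha0
  have huniq : ∀ i', i' ≠ i → a i' = 0 := by
    intro i' hne
    by_contra h
    have := Finset.card_le_one.1 (Nat.lt_succ_iff.1 hlt) i' (by simpa using h) i (by simpa using hi)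
    exact hne this
  -- The shift `+ 1` puts the zeros of the dual word in another class mod 3, so its entry at i is 1.
  have := comp_val_mem_dualCode_powerCode (T := T)
    (columnSeq_recurrence hm (i % 3 ^ v) (i / 3 ^ v + 1)) a ha
  rw [Finset.sum_eq_single i (fun i' _ h => by rw [huniq i' h, mul_zero]) (by simp)] at this
  have hone : columnSeq (3 ^ v) (i % 3 ^ v) (i / 3 ^ v + 1) i = 1 := by
    rw [columnSeq, if_pos rfl, periodicSeq, if_neg (by omega)]
  exact hi (by simpa only [hone, one_mul, Pi.zero_apply] using this)

theorem isMinDist_powerCode (hT : 1 ≤ T) :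
    IsMinDist (powerCode (trinomial v) (2 ^ T) 1) 2 := by
  have hm : 0 < 3 ^ v := by positivity
  have hN := four_le_two_pow_succ hT
  have hlt : 3 * 3 ^ v < (trinomial v ^ 2 ^ T).natDegree := by
    rw [natDegree_trinomial_pow]
    exact Nat.mul_lt_mul_of_pos_right (by omega) hm
  let i₀ : Fin (trinomial v ^ 2 ^ T).natDegree := ⟨0, by omega⟩
  -- From P·(x^m - 1) = x^(3m) - 1 with m = 3^v; 3m < n because N ≥ 4.
  let i₁ : Fin (trinomial v ^ 2 ^ T).natDegree := ⟨3 * 3 ^ v, hlt⟩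
  have hne : i₀ ≠ i₁ := by
    intro h
    have := congrArg Fin.val h
    simp only [i₀, i₁] at this
    omega
  have hnorm : hammingNorm (Pi.single i₀ 1 + Pi.single i₁ 1 :
      Fin (trinomial v ^ 2 ^ T).natDegree → ZMod 2) = 2 := by
    refine Eq.trans (congrArg Finset.card ?_) (Finset.card_pair hne)
    ext i
    by_cases h0 : i = i₀
    · simp [h0, hne]
    · by_cases h1 : i = i₁
      · simp [h1, hne.symm]
      · simp [h0, h1]
  refine isMinDist_of_hammingNorm (w := Pi.single i₀ 1 + Pi.single i₁ 1) ?_ ?_ hnorm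
    fun a ha ha0 => two_le_hammingNorm_of_mem_powerCode ha ha0
  · rw [powerCode_one_eq, mem_polycyclicCode_span_iff trinomial_dvd_pow]
    have hsingle : ∀ i, wordPoly (ZMod 2) (trinomial v ^ 2 ^ T).natDegree (Pi.single i 1) =
        X ^ (i : ℕ) := by
      intro i
      rw [wordPoly_apply, Finset.sum_eq_single i (fun j _ h => by simp [h]) (by simp)]
      simp [X_pow_eq_monomial]
    rw [map_add, hsingle, hsingle]
    refine ⟨X ^ 3 ^ v - 1, ?_⟩
    have h2 : (2 : (ZMod 2)[X]) = 0 := CharTwo.two_eq_zero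
    simp only [i₀, i₁, trinomial]
    linear_combination h2
  · rw [← hammingNorm_ne_zero_iff, hnorm]
    norm_num

theorem finrank_powerCode :
    Module.finrank (ZMod 2) (powerCode (trinomial v) (2 ^ T) 1) =
      3 ^ v * (2 ^ (T + 1) - 2) := by
  have hm : 0 < 3 ^ v := by positivity
  have h2 : 2 ≤ 2 ^ (T + 1) := Nat.le_self_pow (by omega) 2
  have hle := Nat.mul_le_mul_right (3 ^ v) h2
  rw [powerCode_one_eq, finrank_polycyclicCode_span trinomial_dvd_pow (monic_trinomial v),
    natDegree_trinomial_pow, natDegree_trinomial, Nat.mul_sub, mul_comm, mul_comm 2]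
  · rwa [natDegree_trinomial_pow, natDegree_trinomial]
  · rw [natDegree_trinomial_pow]
    positivity

theorem finrank_dualCode_powerCode :
    Module.finrank (ZMod 2) (dualCode (powerCode (trinomial v) (2 ^ T) 1)) = 2 * 3 ^ v := by
  have h2 : 2 ≤ 2 ^ (T + 1) := Nat.le_self_pow (by omega) 2
  have hle := Nat.mul_le_mul_left (3 ^ v) h2
  rw [finrank_dualCode, finrank_powerCode, Fintype.card_fin, natDegree_trinomial_pow,
    Nat.mul_sub, mul_comm (2 ^ (T + 1))]
  omega

end Trinomial

end PolycyclicCode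

theorem theorem28 (v T : ℕ) (hT : 1 ≤ T) :
    PolycyclicCode.IsLCD
        (PolycyclicCode.powerCode (PolycyclicCode.trinomial v) (2 ^ T) 1) ∧
      PolycyclicCode.HasParameters
        (PolycyclicCode.powerCode (PolycyclicCode.trinomial v) (2 ^ T) 1)
        (3 ^ v * 2 ^ (T + 1)) (3 ^ v * (2 ^ (T + 1) - 2)) 2 ∧
      PolycyclicCode.IsLCD (PolycyclicCode.dualCode
        (PolycyclicCode.powerCode (PolycyclicCode.trinomial v) (2 ^ T) 1)) ∧
      ∃ d : ℕ,
        PolycyclicCode.HasParameters (PolycyclicCode.dualCode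
          (PolycyclicCode.powerCode (PolycyclicCode.trinomial v) (2 ^ T) 1))
          (3 ^ v * 2 ^ (T + 1)) (2 * 3 ^ v) d ∧
        (Odd T → (d : ℚ) = (2 ^ (T + 2) - 2) / 3) ∧
        (Even T → (d : ℚ) = (2 ^ (T + 2) - 1) / 3) := by
  have hcard : Fintype.card
      (Fin (PolycyclicCode.trinomial v ^ 2 ^ T).natDegree) = 3 ^ v * 2 ^ (T + 1) := by
    rw [Fintype.card_fin, PolycyclicCode.natDegree_trinomial_pow, mul_comm]
  obtain ⟨q, e, he, hqe⟩ := PolycyclicCode.exists_two_pow_succ_eq T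
  have hqe' : (2 : ℚ) ^ (T + 2) = 2 * (3 * q + e) := by
    rw [pow_succ, mul_comm]
    exact_mod_cast congrArg (2 * ·) hqe.symm
  -- The parity of T fixes e, and 2q + e - 1 = (2^(T+2) + e - 3)/3.
  have hmod : 2 ^ (T + 1) % 3 = if Odd T then 1 else 2 := by
    split_ifs with h
    · obtain ⟨s, rfl⟩ := h
      rw [show 2 * s + 1 + 1 = 2 * (s + 1) by ring, pow_mul, Nat.pow_mod]
      simp
    · obtain ⟨s, rfl⟩ := Nat.not_odd_iff_even.1 h
      rw [← two_mul, pow_succ, pow_mul, Nat.mul_mod, Nat.pow_mod]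
      simp
  refine ⟨PolycyclicCode.isLCD_powerCode hT,
    ⟨hcard, PolycyclicCode.finrank_powerCode, PolycyclicCode.isMinDist_powerCode hT⟩,
    (PolycyclicCode.isLCD_powerCode hT).dualCode, 2 * q + (e - 1),
    ⟨hcard, PolycyclicCode.finrank_dualCode_powerCode,
      PolycyclicCode.isMinDist_dualCode_powerCode hT he hqe⟩, fun hodd => ?_, fun heven => ?_⟩
  · rw [if_pos hodd] at hmod
    obtain rfl : e = 1 := by omega
    rw [hqe']
    push_cast
    ring
  · rw [if_neg (Nat.not_odd_iff_even.2 heven)] at hmod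
    obtain rfl : e = 2 := by omega
    rw [hqe']
    push_cast
    ring
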